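/- For every integer $n\ge 0$, let $c_9(n)$ be the number of partitions of $n$ in which either (a) all parts are distinct and greater than $1$, or (b) there exists an integer $j\ge 2$ such that $1$ appears exactly $j^2$ times as a part and the parts greater than $1$ are distinct and at least $j+1$ in size. (The empty partition of $0$ satisfies (a), so $c_9(0)=1$.) Then, for all $n\ge 0$, $$c_9(n)\equiv\begin{cases}1\pmod 2,& n=\dfrac{5j^2+j}{2}\ \text{for some } j\in\mathbb Z,\\[2mm] 0\pmod 2,&\text{otherwise.}\end{cases}$$ In other words, $c_9(n)$ is odd if and only if $n=(5j^2+j)/2$ for some integer $j$. -/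

import Mathlib

/-- All parts of the partition are distinct and greater than 1. -/
def C9TypeA {n : ℕ} (p : n.Partition) : Prop :=
  p.parts.Nodup ∧ ∀ x ∈ p.parts, 1 < x

/-- For some `j ≥ 2`, the part 1 appears `j ^ 2` times, and the parts greater than 1 are
distinct and at least `j + 1` in size. -/
def C9TypeB {n : ℕ} (p : n.Partition) : Prop :=
  ∃ j : ℕ, 2 ≤ j ∧ p.parts.count 1 = j ^ 2 ∧
    (p.parts.filter (fun x => 1 < x)).Nodup ∧ ∀ x ∈ p.parts, 1 < x → j + 1 ≤ x

open Classical in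
/-- The number of partitions of `n` of one of the two types above. -/
noncomputable def c9 (n : ℕ) : ℕ :=
  (Finset.univ.filter (fun p : n.Partition => C9TypeA p ∨ C9TypeB p)).card

/-! Splitting by the number `j ^ 2` of ones, the generating function of `c9` is the sum over `j ≠ 1`
of `q ^ (j ^ 2) * ∏ (1 + q ^ i)` over `i > max 1 j`. Modulo 2 this is the sum over all `j` of `q ^
(j ^ 2) * ∏ (1 - q ^ i)` over `i > j`, that is, `(q; q)_∞` times the sum side of the first
Rogers–Ramanujan identity, hence a theta series with exponents `(5j² + j)/2`. Rogers–Ramanujan is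
proved with `q` nilpotent, so all sums are finite: both sides satisfy `F m = F (m + 1) + q ^ (m + 1)
* F (m + 2)` and agree for large `m`. -/

open Finset

/-! ### Rogers–Ramanujan for nilpotent `q` -/

section RogersRamanujan

variable {R : Type*} [CommRing R]

/-- The finite product `(1 - q ^ (r + 1)) ⋯ (1 - q ^ (r + m))`. -/
def shiftedQPochhammer (q : R) (r m : ℕ) : R := ∏ i ∈ range m, (1 - q ^ (r + 1 + i))

theorem shiftedQPochhammer_zero (q : R) (r : ℕ) : shiftedQPochhammer q r 0 = 1 := by
  simp [shiftedQPochhammer]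

theorem shiftedQPochhammer_succ (q : R) (r m : ℕ) :
    shiftedQPochhammer q r (m + 1) = shiftedQPochhammer q r m * (1 - q ^ (r + 1 + m)) :=
  prod_range_succ _ _

theorem shiftedQPochhammer_succ' (q : R) (r m : ℕ) :
    shiftedQPochhammer q r (m + 1) = (1 - q ^ (r + 1)) * shiftedQPochhammer q (r + 1) m := by
  simp only [shiftedQPochhammer]
  rw [prod_range_succ', mul_comm]
  congr 1
  refine prod_congr rfl fun i _ => ?_
  congr 2
  ring

theorem shiftedQPochhammer_eq_of_le {q : R} {N m : ℕ} (hq : q ^ (N + 1) = 0) (hm : N ≤ m) :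
    shiftedQPochhammer q 0 m = shiftedQPochhammer q 0 N := by
  induction m, hm using Nat.le_induction with
  | base => rfl
  | succ m hm ih =>
    rw [shiftedQPochhammer_succ, ih, pow_eq_zero_of_le (by omega) hq, sub_zero, mul_one]

/-- The sum side of the Rogers–Ramanujan identity, multiplied by `(q; q)_N`. -/
def rogersSum (q : R) (N m : ℕ) : R :=
  ∑ j ∈ range (N + 1), q ^ (j ^ 2 + m * j) * shiftedQPochhammer q j (N - j)

/-- The theta side of the Rogers–Ramanujan identity. -/
def rogersTheta (q : R) (N m : ℕ) : R :=
  ∑ r ∈ range (N + 1), (-1) ^ r * (q ^ (2 * r * m + (5 * r.choose 2 + 3 * r)) *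
    (1 - q ^ (2 * m + 2 + 4 * r)) * shiftedQPochhammer q r m)

/-- The companion of `rogersTheta` in Rogers's pair of functional equations. -/
def rogersThetaAux (q : R) (N m : ℕ) : R :=
  ∑ r ∈ range (N + 1), (-1) ^ r * (q ^ (2 * r * m + (5 * r.choose 2 + 4 * r)) *
    (1 - q ^ (m + 1 + 2 * r)) * shiftedQPochhammer q r m)

/-- Subtracting the sums for `m` and `m + 1` leaves a factor `1 - q ^ j`, which lengthens the
product by one; shifting `j` gives the third sum. -/
theorem rogersSum_rec {q : R} {N : ℕ} (hq : q ^ (N + 1) = 0) (m : ℕ) :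
    rogersSum q N m = rogersSum q N (m + 1) + q ^ (m + 1) * rogersSum q N (m + 2) := by
  rw [← sub_eq_iff_eq_add']
  simp only [rogersSum]
  rw [← sum_sub_distrib, sum_range_succ', mul_sum, sum_range_succ]
  have hlast : q ^ (m + 1) * (q ^ (N ^ 2 + (m + 2) * N) * shiftedQPochhammer q N (N - N)) = 0 := by
    rw [← mul_assoc, ← pow_add, pow_eq_zero_of_le (by nlinarith) hq, zero_mul]
  rw [hlast]
  simp only [mul_zero, sub_self, add_zero]
  refine sum_congr rfl fun j hj => ?_
  have hj : j < N := mem_range.1 hj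
  obtain ⟨d, rfl⟩ : ∃ d, N = j + 1 + d := ⟨N - (j + 1), by omega⟩
  rw [show j + 1 + d - (j + 1) = d by omega, show j + 1 + d - j = d + 1 by omega,
    shiftedQPochhammer_succ']
  ring

theorem rogersThetaAux_eq {q : R} {N : ℕ} (hq : q ^ (N + 1) = 0) (m : ℕ) :
    rogersThetaAux q N m = rogersTheta q N (m + 1) := by
  rw [← sub_eq_zero]
  simp only [rogersTheta, rogersThetaAux]
  rw [← sum_sub_distrib]
  -- The difference telescopes: this potential vanishes at `r = 0` by the factor `1 - q ^ r`, and at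
  -- `r = N + 1` by nilpotency.
  have key := sum_range_sub' (fun r => (-1) ^ r * ((1 - q ^ r) *
    (q ^ (2 * r * m + (5 * r.choose 2 + 4 * r)) * shiftedQPochhammer q r m))) (N + 1)
  rw [show q ^ (2 * (N + 1) * m + (5 * (N + 1).choose 2 + 4 * (N + 1))) = 0 from
    pow_eq_zero_of_le (by nlinarith) hq] at key
  simp only [pow_zero, sub_self, zero_mul, mul_zero] at key
  rw [← key]
  refine sum_congr rfl fun r _ => ?_
  -- Peeling the first or the last factor off the same product relates the terms at `r` and `r + 1`.
  have h := shiftedQPochhammer_succ' q r m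
  rw [shiftedQPochhammer_succ] at h
  rw [shiftedQPochhammer_succ, Nat.choose_succ_succ' r 1, Nat.choose_one_right]
  linear_combination (-1) ^ r * q ^ (2 * r * m + 2 * m + 5 * r.choose 2 + 9 * r + 4) * h

theorem rogersTheta_sub_rogersThetaAux {q : R} {N : ℕ} (hq : q ^ (N + 1) = 0) (m : ℕ) :
    rogersTheta q N m = rogersThetaAux q N m + q ^ (m + 1) * rogersThetaAux q N (m + 1) := by
  rw [← sub_eq_zero]
  simp only [rogersTheta, rogersThetaAux]
  rw [mul_sum, ← sum_add_distrib, ← sum_sub_distrib]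
  have key := sum_range_sub' (fun r => (-1) ^ r * ((1 - q ^ r) *
    (q ^ (2 * r * m + (5 * r.choose 2 + 3 * r)) * shiftedQPochhammer q r m))) (N + 1)
  rw [show q ^ (2 * (N + 1) * m + (5 * (N + 1).choose 2 + 3 * (N + 1))) = 0 from
    pow_eq_zero_of_le (by nlinarith) hq] at key
  simp only [pow_zero, sub_self, zero_mul, mul_zero] at key
  rw [← key]
  refine sum_congr rfl fun r _ => ?_
  have h := shiftedQPochhammer_succ' q r m
  rw [shiftedQPochhammer_succ] at h
  rw [shiftedQPochhammer_succ, Nat.choose_succ_succ' r 1, Nat.choose_one_right]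
  linear_combination (-1) ^ r * q ^ (2 * r * m + 2 * m + 5 * r.choose 2 + 8 * r + 3) * h

theorem rogersTheta_rec {q : R} {N : ℕ} (hq : q ^ (N + 1) = 0) (m : ℕ) :
    rogersTheta q N m = rogersTheta q N (m + 1) + q ^ (m + 1) * rogersTheta q N (m + 2) := by
  rw [rogersTheta_sub_rogersThetaAux hq, rogersThetaAux_eq hq, rogersThetaAux_eq hq]

theorem rogersSum_eq_of_lt {q : R} {N m : ℕ} (hq : q ^ (N + 1) = 0) (hm : N < m) :
    rogersSum q N m = shiftedQPochhammer q 0 N := by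
  rw [rogersSum, sum_eq_single_of_mem 0 (by simp)]
  · simp
  · intro j _ hj
    rw [pow_eq_zero_of_le _ hq, zero_mul]
    have : 0 < j := Nat.pos_of_ne_zero hj
    nlinarith

theorem rogersTheta_eq_of_lt {q : R} {N m : ℕ} (hq : q ^ (N + 1) = 0) (hm : N < m) :
    rogersTheta q N m = shiftedQPochhammer q 0 N := by
  rw [rogersTheta, sum_eq_single_of_mem 0 (by simp)]
  · rw [← shiftedQPochhammer_eq_of_le hq hm.le,
      pow_eq_zero_of_le (n := 2 * m + 2 + 4 * 0) (by omega) hq]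
    simp
  · intro j _ hj
    rw [pow_eq_zero_of_le _ hq, zero_mul, zero_mul, mul_zero]
    have : 0 < j := Nat.pos_of_ne_zero hj
    nlinarith

/-- The first Rogers–Ramanujan identity modulo `q ^ (N + 1)`, in the one-parameter form due to
Rogers. -/
theorem rogersSum_eq_rogersTheta {q : R} {N : ℕ} (hq : q ^ (N + 1) = 0) (m : ℕ) :
    rogersSum q N m = rogersTheta q N m := by
  -- Descending induction on `m`, starting from `m > N`.
  induction h : N + 1 - m using Nat.strong_induction_on generalizing m with
  | _ k ih =>
    by_cases hm : N < m
    · rw [rogersSum_eq_of_lt hq hm, rogersTheta_eq_of_lt hq hm]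
    · rw [rogersSum_rec hq, rogersTheta_rec hq, ih _ (by omega) (m + 1) rfl,
        ih _ (by omega) (m + 2) rfl]

theorem shiftedQPochhammer_eq_prod_Ioc (h2 : (2 : R) = 0) (q : R) (j N : ℕ) :
    shiftedQPochhammer q j (N - j) = ∏ i ∈ Ioc j N, (1 + q ^ i) := by
  rw [shiftedQPochhammer, ← Ico_add_one_add_one_eq_Ioc, prod_Ico_eq_prod_range,
    Nat.add_sub_add_right]
  refine prod_congr rfl fun i _ => ?_
  linear_combination -q ^ (j + 1 + i) * h2

/-- With `P` the product over `i > 1`, the terms `j = 0, 1` give `(1 + q) * P + q * P = P` in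
characteristic 2. This is why `j = 1` is excluded and type (a) forbids ones. -/
theorem rogersSum_zero_of_two_eq_zero (h2 : (2 : R) = 0) (q : R) (N : ℕ) :
    rogersSum q (N + 1) 0 = ∑ j ∈ (range (N + 2)).erase 1,
      q ^ (j ^ 2) * ∏ i ∈ Ioc (max 1 j) (N + 1), (1 + q ^ i) := by
  have h1 : 1 ∈ range (N + 2) := by simp
  have h0 : 0 ∈ (range (N + 2)).erase 1 := by simp
  simp only [rogersSum, shiftedQPochhammer_eq_prod_Ioc h2, zero_mul, add_zero]
  rw [← add_sum_erase _ _ h1, ← add_sum_erase _ _ h0, ← add_sum_erase _ _ h0]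
  have hp : ∏ i ∈ Ioc 0 (N + 1), (1 + q ^ i) = (1 + q) * ∏ i ∈ Ioc 1 (N + 1), (1 + q ^ i) := by
    have := prod_Ioc_consecutive (fun i => 1 + q ^ i) (Nat.zero_le 1) (Nat.le_add_left 1 N)
    rw [← this]
    simp
  have hs : ∑ j ∈ ((range (N + 2)).erase 1).erase 0,
        q ^ (j ^ 2) * ∏ i ∈ Ioc j (N + 1), (1 + q ^ i) =
      ∑ j ∈ ((range (N + 2)).erase 1).erase 0,
        q ^ (j ^ 2) * ∏ i ∈ Ioc (max 1 j) (N + 1), (1 + q ^ i) := by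
    refine sum_congr rfl fun j hj => ?_
    have : j ≠ 0 := ne_of_mem_erase hj
    rw [max_eq_right (by omega)]
  rw [hs, hp]
  simp only [max_eq_left (Nat.zero_le 1)]
  linear_combination (q * ∏ i ∈ Ioc 1 (N + 1), (1 + q ^ i)) * h2

theorem rogersTheta_zero_of_two_eq_zero (h2 : (2 : R) = 0) (q : R) (N : ℕ) :
    rogersTheta q N 0 = ∑ r ∈ range (N + 1),
      (q ^ (5 * r.choose 2 + 3 * r) + q ^ (5 * r.choose 2 + 7 * r + 2)) := by
  refine sum_congr rfl fun r _ => ?_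
  have hneg : (-1 : R) = 1 := by linear_combination -h2
  rw [hneg, shiftedQPochhammer_zero]
  linear_combination -q ^ (5 * r.choose 2 + 7 * r + 2) * h2

end RogersRamanujan

/-! ### Passage to polynomial coefficients -/

section Coefficients

open Polynomial

theorem map_rogersSum {R S : Type*} [CommRing R] [CommRing S] (f : R →+* S) (q : R) (N m : ℕ) :
    f (rogersSum q N m) = rogersSum (f q) N m := by
  simp [rogersSum, shiftedQPochhammer]

theorem map_rogersTheta {R S : Type*} [CommRing R] [CommRing S] (f : R →+* S) (q : R)
    (N m : ℕ) : f (rogersTheta q N m) = rogersTheta (f q) N m := by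
  simp [rogersTheta, shiftedQPochhammer]

theorem coeff_rogersSum_eq {R : Type*} [CommRing R] {n N : ℕ} (hn : n ≤ N) (m : ℕ) :
    (rogersSum (X : R[X]) N m).coeff n = (rogersTheta (X : R[X]) N m).coeff n := by
  -- The class of `X` modulo `X ^ (N + 1)` is the nilpotent `q`; coefficients up to degree `N`
  -- survive.
  set I : Ideal R[X] := Ideal.span {X ^ (N + 1)}
  have hq : (Ideal.Quotient.mk I X) ^ (N + 1) = 0 := by
    rw [← map_pow, Ideal.Quotient.eq_zero_iff_mem]
    exact Ideal.mem_span_singleton_self _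
  have h := rogersSum_eq_rogersTheta hq m
  rw [← map_rogersSum, ← map_rogersTheta, Ideal.Quotient.eq, Ideal.mem_span_singleton,
    X_pow_dvd_iff] at h
  simpa [sub_eq_zero] using h n (by omega)

theorem coeff_sum_pow_mul_prod_one_add {R : Type*} [CommRing R] (J : Finset ℕ) (e : ℕ → ℕ)
    (s : ℕ → Finset ℕ) (n : ℕ) :
    (∑ j ∈ J, (X : R[X]) ^ e j * ∏ i ∈ s j, (1 + X ^ i)).coeff n =
      ((J.sigma fun j => {t ∈ (s j).powerset | e j + ∑ i ∈ t, i = n}).card : R) := by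
  simp only [prod_one_add, mul_sum, finsetSum_coeff, card_sigma, Nat.cast_sum, card_filter,
    Nat.cast_ite, Nat.cast_one, Nat.cast_zero]
  refine sum_congr rfl fun j _ => sum_congr rfl fun t _ => ?_
  rw [prod_pow_eq_pow_sum, ← pow_add, coeff_X_pow]
  simp only [eq_comm]

end Coefficients

/-! ### Encoding the partitions -/

/-- Type (a) is the case `j = 0` of the condition in (b). -/
theorem c9TypeA_or_c9TypeB_iff {n : ℕ} (p : n.Partition) :
    C9TypeA p ∨ C9TypeB p ↔ ∃ j : ℕ, j ≠ 1 ∧ p.parts.count 1 = j ^ 2 ∧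
      (p.parts.filter (fun x => 1 < x)).Nodup ∧ ∀ x ∈ p.parts, 1 < x → j < x := by
  constructor
  · rintro (⟨hd, h1⟩ | ⟨j, hj, hc, hd, hb⟩)
    · refine ⟨0, by simp, ?_, hd.filter _, fun x _ hx => by omega⟩
      rw [Multiset.count_eq_zero_of_notMem fun h => (h1 1 h).false]
      rfl
    · exact ⟨j, by omega, hc, hd, hb⟩
  · rintro ⟨j, hj, hc, hd, hb⟩
    obtain rfl | h0 := Nat.eq_zero_or_pos j
    · have h1 : ∀ x ∈ p.parts, 1 < x := fun x hx => by
        have h := p.parts_pos hx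
        have : x ≠ 1 := by
          rintro rfl
          exact Multiset.count_eq_zero.1 hc hx
        omega
      rw [Multiset.filter_eq_self.2 h1] at hd
      exact Or.inl ⟨hd, h1⟩
    · exact Or.inr ⟨j, by omega, hc, hd, hb⟩

theorem parts_eq_replicate_add_filter {n : ℕ} (p : n.Partition) :
    p.parts = Multiset.replicate (p.parts.count 1) 1 + p.parts.filter (fun x => 1 < x) := by
  conv_lhs => rw [← Multiset.filter_add_not (fun x => x = 1) p.parts]
  rw [Multiset.filter_eq']
  congr 1
  refine Multiset.filter_congr fun x hx => ?_
  have := p.parts_pos hx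
  omega

theorem filter_replicate_one_add {k : ℕ} {t : Multiset ℕ} (ht : ∀ x ∈ t, 1 < x) :
    (Multiset.replicate k 1 + t).filter (fun x => 1 < x) = t := by
  rw [Multiset.filter_add, Multiset.filter_eq_self.2 ht, Multiset.filter_eq_nil.2, zero_add]
  intro x hx
  rw [Multiset.eq_of_mem_replicate hx]
  exact lt_irrefl 1

theorem count_replicate_one_add {k : ℕ} {t : Multiset ℕ} (ht : ∀ x ∈ t, 1 < x) :
    (Multiset.replicate k 1 + t).count 1 = k := by
  rw [Multiset.count_add, Multiset.count_replicate_self,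
    Multiset.count_eq_zero_of_notMem fun h => (ht 1 h).false, add_zero]

/-- Partitions counted by `c9 n` correspond to pairs of a number `j ≠ 1`, giving the `j ^ 2` parts
equal to `1`, and the finite set of the remaining parts. -/
theorem c9_eq_card_sigma {n N : ℕ} (hn : n ≤ N) :
    c9 n = (((range (N + 1)).erase 1).sigma fun j =>
      {t ∈ (Ioc (max 1 j) N).powerset | j ^ 2 + ∑ i ∈ t, i = n}).card := by
  classical
  have mem_iff : ∀ a : Σ _ : ℕ, Finset ℕ, (a ∈ ((range (N + 1)).erase 1).sigma fun j =>
      {t ∈ (Ioc (max 1 j) N).powerset | j ^ 2 + ∑ i ∈ t, i = n}) ↔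
      (a.1 ≠ 1 ∧ a.1 < N + 1) ∧ (∀ x ∈ a.2, (1 < x ∧ a.1 < x) ∧ x ≤ N) ∧
        a.1 ^ 2 + ∑ i ∈ a.2, i = n := by
    intro a
    simp [subset_iff]
  symm
  refine card_bij (fun a ha => ⟨Multiset.replicate (a.1 ^ 2) 1 + a.2.val, ?_, ?_⟩) ?_ ?_ ?_
  · intro x hx
    rw [mem_iff] at ha
    obtain hx | hx := Multiset.mem_add.1 hx
    · simp [Multiset.eq_of_mem_replicate hx]
    · exact zero_lt_one.trans (ha.2.1 x hx).1.1
  · rw [mem_iff] at ha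
    rw [Multiset.sum_add, Multiset.sum_replicate, smul_eq_mul, mul_one, sum_val]
    exact ha.2.2
  · intro a ha
    rw [mem_iff] at ha
    have h1 : ∀ x ∈ a.2.val, 1 < x := fun x hx => (ha.2.1 x hx).1.1
    rw [mem_filter, c9TypeA_or_c9TypeB_iff]
    refine ⟨mem_univ _, a.1, ha.1.1, count_replicate_one_add h1, ?_, ?_⟩
    · rw [filter_replicate_one_add h1]
      exact a.2.nodup
    · intro x hx hx1
      obtain hx | hx := Multiset.mem_add.1 hx
      · exact absurd (Multiset.eq_of_mem_replicate hx) hx1.ne'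
      · exact (ha.2.1 x hx).1.2
  · rintro ⟨j, t⟩ ha ⟨j', t'⟩ hb hab
    rw [mem_iff] at ha hb
    have h1 : ∀ x ∈ t.val, 1 < x := fun x hx => (ha.2.1 x hx).1.1
    have h1' : ∀ x ∈ t'.val, 1 < x := fun x hx => (hb.2.1 x hx).1.1
    have hparts := congrArg Nat.Partition.parts hab
    dsimp only at hparts
    have hj : j ^ 2 = j' ^ 2 := by
      rw [← count_replicate_one_add (k := j ^ 2) h1, hparts, count_replicate_one_add h1']
    have ht : t.val = t'.val := by
      rw [← filter_replicate_one_add (k := j ^ 2) h1, hparts, filter_replicate_one_add h1']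
    obtain rfl := Nat.pow_left_injective two_ne_zero hj
    obtain rfl := val_injective ht
    rfl
  · intro p hp
    rw [mem_filter, c9TypeA_or_c9TypeB_iff] at hp
    obtain ⟨-, j, hj, hc, hd, hb⟩ := hp
    have hparts := parts_eq_replicate_add_filter p
    rw [hc] at hparts
    have hsum : j ^ 2 + (p.parts.filter (fun x => 1 < x)).sum = n := by
      have h := congrArg Multiset.sum hparts
      rw [p.parts_sum, Multiset.sum_add, Multiset.sum_replicate, smul_eq_mul, mul_one] at h
      exact h.symm
    refine ⟨⟨j, ⟨p.parts.filter (fun x => 1 < x), hd⟩⟩, ?_, Nat.Partition.ext hparts.symm⟩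
    rw [mem_iff]
    refine ⟨⟨hj, ?_⟩, ?_, ?_⟩
    · dsimp only
      have := Nat.le_self_pow two_ne_zero j
      omega
    · intro x hx
      obtain ⟨hx, hx1⟩ := Multiset.mem_filter.1 hx
      exact ⟨⟨hx1, hb x hx hx1⟩, (Nat.Partition.le_of_mem_parts hx).trans hn⟩
    · exact (congrArg (j ^ 2 + ·) (sum_val ⟨_, hd⟩).symm).trans hsum

open Polynomial in
theorem cast_c9 (n : ℕ) : (c9 n : ZMod 2) = ∑ r ∈ range (n + 2),
    ((if n = 5 * r.choose 2 + 3 * r then 1 else 0) +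
      if n = 5 * r.choose 2 + 7 * r + 2 then 1 else 0) := by
  have h2 : (2 : (ZMod 2)[X]) = 0 := CharTwo.two_eq_zero
  -- Truncating at `n + 1` rather than `n` keeps the `j = 1` term available when `n = 0`.
  rw [c9_eq_card_sigma (Nat.le_succ n),
    ← coeff_sum_pow_mul_prod_one_add _ (fun j => j ^ 2) (fun j => Ioc (max 1 j) (n + 1)),
    ← rogersSum_zero_of_two_eq_zero h2, coeff_rogersSum_eq (Nat.le_succ n),
    rogersTheta_zero_of_two_eq_zero h2]
  simp only [finsetSum_coeff, coeff_add, coeff_X_pow]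

/-! ### Arithmetic of the exponents -/

theorem two_mul_choose_two_cast (r : ℕ) : 2 * (r.choose 2 : ℤ) = r * (r - 1) := by
  induction r with
  | zero => simp
  | succ r ih =>
    rw [Nat.choose_succ_succ' r 1, Nat.choose_one_right]
    push_cast
    linear_combination ih

theorem eq_five_mul_choose_two_add_three_mul_iff (n r : ℕ) :
    n = 5 * r.choose 2 + 3 * r ↔ 2 * (n : ℤ) = 5 * (r : ℤ) ^ 2 + r := by
  have := two_mul_choose_two_cast r
  zify
  constructor <;> intro h <;> linarith

theorem eq_five_mul_choose_two_add_seven_mul_iff (n r : ℕ) :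
    n = 5 * r.choose 2 + 7 * r + 2 ↔
      2 * (n : ℤ) = 5 * (-(r + 1 : ℤ)) ^ 2 + -(r + 1 : ℤ) := by
  have := two_mul_choose_two_cast r
  zify
  constructor <;> intro h <;> linarith

theorem five_mul_sq_add_self_injective : Function.Injective fun j : ℤ => 5 * j ^ 2 + j := by
  intro a b h
  dsimp only at h
  have h' : (a - b) * (5 * (a + b) + 1) = 0 := by linear_combination h
  -- The second factor is nonzero, being 1 modulo 5.
  obtain h' | h' := mul_eq_zero.1 h' <;> omega

theorem theorem10 (n : ℕ) :
    ((∃ j : ℤ, (n : ℚ) = (5 * (j : ℚ) ^ 2 + (j : ℚ)) / 2) → c9 n ≡ 1 [MOD 2]) ∧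
    ((¬ ∃ j : ℤ, (n : ℚ) = (5 * (j : ℚ) ^ 2 + (j : ℚ)) / 2) → c9 n ≡ 0 [MOD 2]) := by
  have hiff : ∀ j : ℤ, (n : ℚ) = (5 * (j : ℚ) ^ 2 + (j : ℚ)) / 2 ↔
      2 * (n : ℤ) = 5 * j ^ 2 + j := by
    intro j
    rw [eq_div_iff two_ne_zero, mul_comm]
    exact_mod_cast Iff.rfl
  simp only [hiff, ← ZMod.natCast_eq_natCast_iff, cast_c9,
    eq_five_mul_choose_two_add_three_mul_iff, eq_five_mul_choose_two_add_seven_mul_iff]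
  constructor
  · rintro ⟨j, hj⟩
    have inj : ∀ i : ℤ, 5 * j ^ 2 + j = 5 * i ^ 2 + i ↔ j = i :=
      fun i => five_mul_sq_add_self_injective.eq_iff
    simp only [hj, inj]
    -- The two exponent families are indexed by `j ≥ 0` and `j < 0`, so exactly one indicator in the
    -- sum is 1.
    obtain ⟨r, hr⟩ : ∃ r : ℕ, j = r ∨ j = -(r + 1 : ℤ) := by
      obtain h | h := le_or_gt 0 j
      · exact ⟨j.toNat, by omega⟩
      · exact ⟨(-j - 1).toNat, by omega⟩
    have hlt : r < n + 2 := by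
      zify
      obtain rfl | rfl := hr <;> nlinarith
    rw [sum_eq_single_of_mem r (mem_range.2 hlt)]
    · obtain rfl | rfl := hr
      · rw [if_pos rfl, if_neg (by omega), add_zero, Nat.cast_one]
      · rw [if_pos rfl, if_neg (by omega), zero_add, Nat.cast_one]
    · intro i _ hi
      rw [if_neg (by omega), if_neg (by omega), add_zero]
  · intro h
    push Not at h
    simp [h]
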